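/- Let $d\ge 3$ and $R\ge 1$ be integers, let $\alpha\in[0,1]$, let $|\cdot|_1$ be the $\ell^1$-norm on $\mathbb Z^d$, and let $B_1(R)=\{x\in\mathbb Z^d:|x|_1\le R\}$. The voter model of range $R$ on $\mathbb Z^d$ is the Feller process $(\xi_t)_{t\ge 0}$ on $\{0,1\}^{\mathbb Z^d}$ whose generator is given, on functions $f$ that depend on finitely many coordinates, by $$(\mathcal L f)(\xi)=\sum_{x,y\in\mathbb Z^d:\ 0<|x-y|_1\le R}\frac{f(\xi^{y\to x})-f(\xi)}{|B_1(R)|-1},$$ where $\xi^{y\to x}(x)=\xi(y)$ and $\xi^{y\to x}(z)=\xi(z)$ for $z\ne x$. Let $\pi_\alpha$ be the product Bernoulli($\alpha$) measure on $\{0,1\}^{\mathbb Z^d}$ (each site has state $1$ with probability $\alpha$), and let $\mu_{\alpha,R}$ be the distributional limit, as $t\to\infty$, of the law of $\xi_t$ for the process started from $\pi_\alpha$. An $R$-spread-out random walk on $\mathbb Z^d$ is the continuous-time random walk with independent Exponential(1) holding times and independent jumps uniformly distributed on $B_1(R)\setminus\{0\}$. Let $h_R(u,v)$ be the probability that two independent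 $R$-spread-out random walks started at $u$ and $v$ are ever at the same site at the same time. For a finite set $B\subseteq\mathbb Z^d$ let $\mathcal F_B$ be the collection of events $\{\xi:\xi|_B\in E_0\}$ with $E_0\subseteq\{0,1\}^B$. For $x\in\mathbb Z^d$ and an event $E$ put $\theta_xE=\{\xi(\cdot-x):\xi\in E\}$. Let $\prec$ be a well-ordering of $\mathbb Z^d$. Let $B\subseteq\mathbb Z^d$ be finite with $0\in B$, and let $x_1,\dots,x_n\in\mathbb Z^d$ be such that the sets $x_i+B$, $1\le i\le n$, are pairwise disjoint. Then, for every $E\in\mathcal F_B$, $$\mu_{\alpha,R}\Big(\bigcap_{i=1}^n\theta_{x_i}E\Big)\le \pi_\alpha(E)^n\cdot\prod_{\substack{u,v\in\bigcup_i(x_i+B)\\ u\prec v}}\Big(1+h_R(u,v)\big(\pi_\alpha(E)^{-2}-1\big)\Big).$$ If $\pi_\alpha(E)=0$ and $n\ge 1$, the right-hand side is read as $0$. -/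

import Mathlib

open MeasureTheory ProbabilityTheory Filter Topology
open scoped NNReal unitInterval

noncomputable section

namespace VoterModel

/-- The lattice `ℤ^d`. -/
abbrev Site (d : ℕ) : Type := Fin d → ℤ

/-- Configurations in `{0,1}^(ℤ^d)`, with the product topology and the product `σ`-algebra;
`true` is the state `1` and `false` is the state `0`. -/
abbrev Config (d : ℕ) : Type := Site d → Bool

/-- The `ℓ¹`-norm on `ℤ^d`. -/
def l1 {d : ℕ} (x : Site d) : ℕ := ∑ i, (x i).natAbs

/-- The ball `B_1(R)` of radius `R` around the origin in the `ℓ¹`-norm. -/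
def ball1 (d R : ℕ) : Set (Site d) := {x | l1 x ≤ R}

/-- `𝓕_A`: the events that are determined by the states of the sites of `A`. -/
def cylinderSets {d : ℕ} (A : Finset (Site d)) : Set (Set (Config d)) :=
  {E | ∃ E₀ : Set (A → Bool), E = {ξ | (A.restrict ξ : A → Bool) ∈ E₀}}

/-- The translated configuration `τ_x ξ`. -/
def shift {d : ℕ} (x : Site d) (ξ : Config d) : Config d := fun y => ξ (y - x)

/-- The translated event `θ_x E`. -/
def shiftEvent {d : ℕ} (x : Site d) (E : Set (Config d)) : Set (Config d) := shift x '' E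

/-- `π_α`: the states of the sites are independent and Bernoulli(`α`) distributed. -/
def productBernoulli (d : ℕ) (α : I) : Measure (Config d) :=
  Measure.infinitePi fun _ : Site d => bernoulliMeasure true false α

/-! ### The voter model and its stationary measures -/

/-- `ξ^{y → x}`: the site `x` copies the state of the site `y`. -/
def copy {d : ℕ} (ξ : Config d) (y x : Site d) : Config d := Function.update ξ x (ξ y)

open Classical in
/-- The pregenerator of the voter model of range `R`; it is meant for functions `f` that depend on
finitely many coordinates, for which only finitely many terms of the sum are nonzero. -/
def pregenerator (d R : ℕ) (f : Config d → ℝ) (ξ : Config d) : ℝ :=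
  ∑' p : Site d × Site d,
    if 0 < l1 (p.1 - p.2) ∧ l1 (p.1 - p.2) ≤ R then
      (f (copy ξ p.2 p.1) - f ξ) / (((ball1 d R).ncard : ℝ) - 1)
    else 0

/-- A Markov semigroup on the space of continuous functions on a compact space `X`: the transition
semigroup `S t f (ξ) = E^ξ[f(ξ_t)]` of a Feller process. -/
structure IsMarkovSemigroup {X : Type*} [TopologicalSpace X] [CompactSpace X]
    (S : ℝ≥0 → C(X, ℝ) →ₗ[ℝ] C(X, ℝ)) : Prop where
  zero : S 0 = LinearMap.id
  rightContinuous : ∀ (f : C(X, ℝ)) (t : ℝ≥0),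
    ContinuousWithinAt (fun s => S s f) (Set.Ici t) t
  add : ∀ (s t : ℝ≥0) (f : C(X, ℝ)), S (s + t) f = S s (S t f)
  one : ∀ t : ℝ≥0, S t 1 = 1
  nonneg : ∀ (t : ℝ≥0) (f : C(X, ℝ)), 0 ≤ f → 0 ≤ S t f

/-- `S` is the transition semigroup of the voter model of range `R` on `ℤ^d`: a Markov semigroup
whose generator is given by `pregenerator d R` on the functions of finitely many coordinates. -/
structure IsVoterSemigroup (d R : ℕ) (S : ℝ≥0 → C(Config d, ℝ) →ₗ[ℝ] C(Config d, ℝ)) :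
    Prop where
  markov : IsMarkovSemigroup S
  generator : ∀ (A : Finset (Site d)) (f : C(Config d, ℝ)), DependsOn f (A : Set (Site d)) →
    TendstoUniformly (fun (t : ℝ≥0) ξ => (S t f ξ - f ξ) / (t : ℝ)) (pregenerator d R f)
      (𝓝[>] (0 : ℝ≥0))

/-- `μ` is the measure `μ_{α,R}`: the distributional limit, as time tends to infinity, of the voter
model of range `R` on `ℤ^d` started from `π_α`. Its law at time `t` integrates the continuous
function `f` to `∫ S t f ∂π_α`. -/
def IsVoterLimit (d R : ℕ) (α : I) (μ : Measure (Config d)) : Prop :=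
  IsProbabilityMeasure μ ∧
    ∃ S : ℝ≥0 → C(Config d, ℝ) →ₗ[ℝ] C(Config d, ℝ), IsVoterSemigroup d R S ∧
      ∀ f : C(Config d, ℝ),
        Tendsto (fun t : ℝ≥0 => ∫ ξ, S t f ξ ∂(productBernoulli d α)) atTop
          (𝓝 (∫ ξ, f ξ ∂μ))

/-! ### Spread-out random walks -/

/-- The law of the driving randomness of an `R`-spread-out walk: an i.i.d. sequence of pairs, each
consisting of an Exponential(1) holding time and an independent jump that is uniformly distributed
on `B_1(R) \ {0}`. -/
def walkMeasure (d R : ℕ) : Measure (ℕ → ℝ × Site d) :=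
  Measure.infinitePi fun _ : ℕ => (expMeasure 1).prod (uniformOn (ball1 d R \ {0}))

/-- The number of jumps up to and including time `t`, the `k`-th holding time being `(ω k).1`. -/
def jumpCount {d : ℕ} (ω : ℕ → ℝ × Site d) (t : ℝ) : ℕ :=
  sInf {m : ℕ | t < ∑ k ∈ Finset.range (m + 1), (ω k).1}

/-- The position at time `t` of the walk started at `z`, the `k`-th jump being `(ω k).2`. -/
def walk {d : ℕ} (z : Site d) (ω : ℕ → ℝ × Site d) (t : ℝ) : Site d :=
  z + ∑ k ∈ Finset.range (jumpCount ω t), (ω k).2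

/-- `h_R(u,v)`: the probability that two independent `R`-spread-out walks started at `u` and `v`
ever meet. -/
def meetProb {d : ℕ} (R : ℕ) (u v : Site d) : ℝ :=
  ((walkMeasure d R).prod (walkMeasure d R)).real
    {p | ∃ t : ℝ, 0 ≤ t ∧ walk u p.1 t = walk v p.2 t}

end VoterModel

end

/-!
Let `p = π_α(E)` and `a = p⁻² - 1`. By duality, the probability that the voter model at time `t` has
prescribed states on the blocks `x_i + B` solves, as a function of the positions `X` of the sites of
all the blocks, the backward equation of coalescing walks. It is dominated by `p ^ n * W`, where
`W X` is the sum over all matchings of the sites of `∏ a * h_R(X u, X v)` over the matched pairs.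
While the positions are distinct, the walks are independent and `h_R` is superharmonic for each
pair, so `W` is superharmonic. When two walks collide, the (at most two) blocks that contain them
are dropped from the event, which costs a factor `p⁻² = 1 + a`; this is made up for by the matchings
that contain the colliding pair, since `h_R = 1` on the diagonal. The maximum principle then gives
the bound for all `t`, and expanding `∏ (1 + a * h_R)` over all pairs gives at least `W`.
-/

noncomputable section

namespace VoterModel

/-! ### Markov semigroups and the comparison principle -/

section Semigroup

variable {X : Type*} [TopologicalSpace X] [CompactSpace X]

namespace IsMarkovSemigroup

variable {S : ℝ≥0 → C(X, ℝ) →ₗ[ℝ] C(X, ℝ)}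

theorem mono (hS : IsMarkovSemigroup S) (t : ℝ≥0) : Monotone (S t) := fun f g hfg => by
  simpa using hS.nonneg t (g - f) (sub_nonneg.2 hfg)

theorem norm_apply_le (hS : IsMarkovSemigroup S) (t : ℝ≥0) (f : C(X, ℝ)) : ‖S t f‖ ≤ ‖f‖ := by
  refine (ContinuousMap.norm_le _ (norm_nonneg f)).2 fun x => abs_le.2 ⟨?_, ?_⟩
  · have h : -(‖f‖ • (1 : C(X, ℝ))) ≤ f := fun y => by
      simpa using (abs_le.1 (f.norm_coe_le_norm y)).1
    simpa [hS.one] using hS.mono t h x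
  · have h : f ≤ ‖f‖ • (1 : C(X, ℝ)) := fun y => by
      simpa using (abs_le.1 (f.norm_coe_le_norm y)).2
    simpa [hS.one] using hS.mono t h x

theorem continuous_apply (hS : IsMarkovSemigroup S) (t : ℝ≥0) : Continuous (S t) :=
  AddMonoidHomClass.continuous_of_bound (S t) 1 fun f => by simpa using hS.norm_apply_le t f

theorem dist_apply_le (hS : IsMarkovSemigroup S) (f : C(X, ℝ)) (s t : ℝ≥0) :
    dist (S s f) (S t f) ≤ dist (S (nndist s t) f) f := by
  wlog hst : t ≤ s generalizing s t
  · simpa only [dist_comm, nndist_comm] using this t s (le_of_not_ge hst)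
  obtain ⟨r, rfl⟩ := exists_add_of_le hst
  have hr : nndist (t + r) t = r := by ext; simp [NNReal.dist_eq]
  rw [hr, hS.add, dist_eq_norm, dist_eq_norm, ← map_sub]
  exact hS.norm_apply_le t _

theorem continuous (hS : IsMarkovSemigroup S) (f : C(X, ℝ)) : Continuous fun t => S t f := by
  refine continuous_iff_continuousAt.2 fun t => tendsto_iff_dist_tendsto_zero.2 ?_
  have hzero : Tendsto (fun r => dist (S r f) f) (𝓝 0) (𝓝 0) := by
    have h := hS.rightContinuous f 0
    rw [ContinuousWithinAt, ← bot_eq_zero, Set.Ici_bot, nhdsWithin_univ, bot_eq_zero, hS.zero] at h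
    exact tendsto_iff_dist_tendsto_zero.1 h
  have hdist : Tendsto (fun s => nndist s t) (𝓝 t) (𝓝 0) := by
    simpa using (continuous_id.nndist (continuous_const (y := t))).tendsto t
  exact squeeze_zero (fun _ => dist_nonneg) (fun s => hS.dist_apply_le f s t) (hzero.comp hdist)

theorem hasDerivWithinAt (hS : IsMarkovSemigroup S) {f g : C(X, ℝ)}
    (hfg : Tendsto (fun h : ℝ≥0 => (h : ℝ)⁻¹ • (S h f - f)) (𝓝[>] 0) (𝓝 g)) (t : ℝ≥0) :
    HasDerivWithinAt (fun s : ℝ => S s.toNNReal f) (S t g) (Set.Ici (t : ℝ)) t := by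
  rw [← hasDerivWithinAt_Ioi_iff_Ici, hasDerivWithinAt_iff_tendsto_slope' (by simp)]
  have hlim : Tendsto (fun s : ℝ => (s - t).toNNReal) (𝓝[>] (t : ℝ)) (𝓝[>] 0) := by
    refine tendsto_nhdsWithin_iff.2 ⟨?_, ?_⟩
    · have h : Continuous fun s : ℝ => (s - t).toNNReal := by fun_prop
      simpa using (h.tendsto t).mono_left nhdsWithin_le_nhds
    · filter_upwards [self_mem_nhdsWithin] with s hs
      simpa using hs
  refine (((hS.continuous_apply t).tendsto g).comp (hfg.comp hlim)).congr' ?_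
  filter_upwards [self_mem_nhdsWithin] with s hs
  have hst : s.toNNReal = t + (s - t).toNNReal := by
    simpa using Real.toNNReal_add t.coe_nonneg (sub_nonneg.2 hs.le)
  simp [slope, hst, hS.add, Real.coe_toNNReal _ (sub_nonneg.2 (Set.mem_Ioi.1 hs).le)]

end IsMarkovSemigroup

variable [MeasurableSpace X] [BorelSpace X] (π : Measure X) [IsFiniteMeasure π]

theorem integrable_continuousMap (f : C(X, ℝ)) : Integrable f π :=
  f.continuous.integrable_of_hasCompactSupport (HasCompactSupport.of_compactSpace f)

/-- Integration against a finite measure, as a continuous functional on `C(X, ℝ)`. -/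
def integralFunctional : C(X, ℝ) →L[ℝ] ℝ :=
  LinearMap.mkContinuous
    { toFun := fun f => ∫ x, f x ∂π
      map_add' := fun f g =>
        integral_add (integrable_continuousMap π f) (integrable_continuousMap π g)
      map_smul' := fun c f => integral_const_mul c f }
    (π.real Set.univ) fun f => by
      simpa [mul_comm] using norm_integral_le_of_norm_le_const (μ := π)
        (Eventually.of_forall f.norm_coe_le_norm)

theorem integralFunctional_mono : Monotone (integralFunctional π) := fun f g hfg =>
  integral_mono (integrable_continuousMap π f) (integrable_continuousMap π g) hfg

end Semigroup

section Comparison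

theorem le_one_sub_exp_mul_of_deriv_right_le {f f' : ℝ → ℝ} {C K T : ℝ} (hC : 0 < C)
    (hf : ContinuousOn f (Set.Icc 0 T))
    (hf' : ∀ t ∈ Set.Ico 0 T, HasDerivWithinAt f (f' t) (Set.Ici t) t) (h0 : f 0 ≤ 0)
    (hbound : ∀ t ∈ Set.Ico 0 T, f' t ≤ C * (K - f t)) {t : ℝ} (ht : t ∈ Set.Icc 0 T) :
    f t ≤ (1 - Real.exp (-(C * t))) * K := by
  have h := le_gronwallBound_of_liminf_deriv_right_le (K := -C) (ε := C * K) hf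
    (fun s hs r hr => (hf' s hs).liminf_right_slope_le hr) h0
    (fun s hs => by linarith [hbound s hs]) t ht
  rw [gronwallBound_of_K_ne_0 (neg_ne_zero.2 hC.ne')] at h
  refine h.trans_eq ?_
  simp only [sub_zero, neg_mul]
  field_simp
  ring

variable {Y : Type*} {L : (Y → ℝ) →ₗ[ℝ] (Y → ℝ)} {C : ℝ} {g : Y → ℝ → ℝ} {W : Y → ℝ}

theorem sub_le_one_sub_exp_mul (hC : 0 < C)
    (hL : ∀ (φ : Y → ℝ) (K : ℝ), (∀ z, φ z ≤ K) → ∀ y, L φ y ≤ C * (K - φ y))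
    (hcont : ∀ y, ContinuousOn (g y) (Set.Ici 0))
    (hderiv : ∀ y t, 0 ≤ t → HasDerivWithinAt (g y) (L (g · t) y) (Set.Ici t) t)
    (hW : ∀ y, (∀ t, 0 ≤ t → g y t ≤ W y) ∨ L W y ≤ 0 ∧ g y 0 ≤ W y)
    {K T : ℝ} (hK : 0 ≤ K) (hD : ∀ y, ∀ t ∈ Set.Icc 0 T, g y t - W y ≤ K)
    (y : Y) {t : ℝ} (ht : t ∈ Set.Icc 0 T) :
    g y t - W y ≤ (1 - Real.exp (-(C * T))) * K := by
  have hexp : Real.exp (-(C * T)) ≤ Real.exp (-(C * t)) := by gcongr; exact ht.2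
  have hexp' : Real.exp (-(C * t)) ≤ 1 :=
    Real.exp_le_one_iff.2 (neg_nonpos.2 (mul_nonneg hC.le ht.1))
  obtain hle | ⟨hLW, h0⟩ := hW y
  · exact (sub_nonpos.2 (hle t ht.1)).trans (mul_nonneg (by linarith) hK)
  refine (le_one_sub_exp_mul_of_deriv_right_le hC (f := fun t => g y t - W y)
    (((hcont y).mono Set.Icc_subset_Ici_self).sub continuousOn_const)
    (fun s hs => (hderiv y s hs.1).sub_const (W y)) (sub_nonpos.2 h0) (fun s hs => ?_) ht).trans
    (by gcongr)
  have h := hL ((g · s) - W) K (fun z => hD z s ⟨hs.1, hs.2.le⟩) y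
  simp only [map_sub, Pi.sub_apply] at h
  linarith

theorem comparison_principle (hC : 0 < C)
    (hL : ∀ (φ : Y → ℝ) (K : ℝ), (∀ z, φ z ≤ K) → ∀ y, L φ y ≤ C * (K - φ y))
    (hcont : ∀ y, ContinuousOn (g y) (Set.Ici 0))
    (hderiv : ∀ y t, 0 ≤ t → HasDerivWithinAt (g y) (L (g · t) y) (Set.Ici t) t)
    (hW : ∀ y, (∀ t, 0 ≤ t → g y t ≤ W y) ∨ L W y ≤ 0 ∧ g y 0 ≤ W y)
    {M : ℝ} (hM : ∀ y t, 0 ≤ t → g y t - W y ≤ M) (y : Y) {T : ℝ} (hT : 0 ≤ T) :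
    g y T ≤ W y := by
  let D : Y × Set.Icc 0 T → ℝ := fun p => max (g p.1 p.2 - W p.1) 0
  have hbdd : BddAbove (Set.range D) := by
    refine ⟨max M 0, ?_⟩
    rintro _ ⟨p, rfl⟩
    exact max_le_max_right 0 (hM _ _ p.2.2.1)
  let p₀ : Y × Set.Icc 0 T := (y, ⟨T, hT, le_rfl⟩)
  have : Nonempty (Y × Set.Icc 0 T) := ⟨p₀⟩
  have hK : 0 ≤ ⨆ p, D p := Real.iSup_nonneg fun _ => le_max_right _ _
  have hq : 0 < Real.exp (-(C * T)) := Real.exp_pos _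
  have hq' : Real.exp (-(C * T)) ≤ 1 :=
    Real.exp_le_one_iff.2 (neg_nonpos.2 (mul_nonneg hC.le hT))
  have himp : ⨆ p, D p ≤ (1 - Real.exp (-(C * T))) * ⨆ p, D p :=
    ciSup_le fun p => max_le
      (sub_le_one_sub_exp_mul hC hL hcont hderiv hW hK
        (fun z t ht => (le_max_left _ _).trans (le_ciSup hbdd (z, ⟨t, ht⟩))) p.1 p.2.2)
      (mul_nonneg (by linarith) hK)
  have hzero : ⨆ p, D p ≤ 0 := by nlinarith
  linarith [(le_max_left _ _).trans (le_ciSup hbdd p₀)]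

end Comparison

/-! ### Coalescing walks and matchings -/

section CoalescingWalks

variable {κ V E F : Type*} [DecidableEq V]

/-- All walkers at `z` move to `y`; the position of the walker `i` is `X i`. -/
def move (X : κ → V) (z y : V) : κ → V := fun i => if X i = z then y else X i

theorem apply_move_of_notMem {T : Type*} {φ : (κ → V) → T} {P : Set κ} (hφ : DependsOn φ P)
    {X : κ → V} {z : V} (hz : z ∉ X '' P) (y : V) : φ (move X z y) = φ X :=
  hφ fun i hi => if_neg fun h => hz ⟨i, hi, h⟩

variable [Add V] [AddCommGroup E] [Module ℝ E] [AddCommGroup F] [Module ℝ F]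

/-- The generator of the coalescing walks with labels in `A` whose jumps are uniform on `s`: each
occupied site `z` rings at rate one, and then all the walkers at `z` jump together. The functions
may take values in any real vector space, so that the generator can be applied to functions of both
the walkers and a configuration. -/
def coalGen (s : Finset V) (A : Finset κ) : ((κ → V) → E) →ₗ[ℝ] ((κ → V) → E) where
  toFun Φ X := ∑ z ∈ A.image X, ∑ w ∈ s, (s.card : ℝ)⁻¹ • (Φ (move X z (z + w)) - Φ X)
  map_add' Φ Ψ := by
    funext X
    simp only [Pi.add_apply, ← Finset.sum_add_distrib, ← smul_add, add_sub_add_comm]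
  map_smul' c Φ := by
    funext X
    simp only [Pi.smul_apply, RingHom.id_apply, Finset.smul_sum, smul_sub, smul_comm c]

variable {s : Finset V} {A : Finset κ}

theorem coalGen_apply (Φ : (κ → V) → E) (X : κ → V) :
    coalGen s A Φ X
      = ∑ z ∈ A.image X, ∑ w ∈ s, (s.card : ℝ)⁻¹ • (Φ (move X z (z + w)) - Φ X) := rfl

theorem map_coalGen (T : E →ₗ[ℝ] F) (Φ : (κ → V) → E) (X : κ → V) :
    T (coalGen s A Φ X) = coalGen s A (fun Y => T (Φ Y)) X := by
  simp only [coalGen_apply, map_sum, map_smul, map_sub]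

theorem coalGen_le {φ : (κ → V) → ℝ} {K : ℝ} (hφ : ∀ Y, φ Y ≤ K) (X : κ → V) :
    coalGen s A φ X ≤ A.card * (K - φ X) := by
  have hK : 0 ≤ K - φ X := sub_nonneg.2 (hφ X)
  have hsite : ∀ z ∈ A.image X,
      ∑ w ∈ s, (s.card : ℝ)⁻¹ • (φ (move X z (z + w)) - φ X) ≤ K - φ X := fun z _ =>
    calc ∑ w ∈ s, (s.card : ℝ)⁻¹ • (φ (move X z (z + w)) - φ X)
        ≤ ∑ _w ∈ s, (s.card : ℝ)⁻¹ * (K - φ X) :=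
          Finset.sum_le_sum fun w _ => by rw [smul_eq_mul]; gcongr; exact hφ _
      _ = s.card * (s.card : ℝ)⁻¹ * (K - φ X) := by
          rw [Finset.sum_const, nsmul_eq_mul, mul_assoc]
      _ ≤ K - φ X := mul_le_of_le_one_left hK mul_inv_le_one
  calc coalGen s A φ X ≤ ∑ _z ∈ A.image X, (K - φ X) := Finset.sum_le_sum hsite
    _ = (A.image X).card * (K - φ X) := by rw [Finset.sum_const, nsmul_eq_mul]
    _ ≤ A.card * (K - φ X) := by gcongr; exact Finset.card_image_le

theorem coalGen_mul_of_disjoint {φ ψ : (κ → V) → ℝ} {P Q : Set κ} (hφ : DependsOn φ P)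
    (hψ : DependsOn ψ Q) {X : κ → V} (hX : Disjoint (X '' P) (X '' Q)) :
    coalGen s A (φ * ψ) X = coalGen s A φ X * ψ X + φ X * coalGen s A ψ X := by
  simp only [coalGen_apply, Finset.sum_mul, Finset.mul_sum, ← Finset.sum_add_distrib]
  refine Finset.sum_congr rfl fun z _ => Finset.sum_congr rfl fun w _ => ?_
  simp only [Pi.mul_apply, smul_eq_mul]
  by_cases hz : z ∈ X '' P
  · rw [apply_move_of_notMem hψ (Set.disjoint_left.1 hX hz)]
    ring
  · rw [apply_move_of_notMem hφ hz]
    ring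

theorem coalGen_pair {η : V → V → ℝ} {u v : κ} (hu : u ∈ A) (hv : v ∈ A) {X : κ → V}
    (huv : X u ≠ X v) :
    coalGen s A (fun Y => η (Y u) (Y v)) X = (s.card : ℝ)⁻¹ *
      (∑ w ∈ s, (η (X u + w) (X v) - η (X u) (X v))
        + ∑ w ∈ s, (η (X u) (X v + w) - η (X u) (X v))) := by
  have hdep : DependsOn (fun Y : κ → V => η (Y u) (Y v)) {u, v} := fun Y Z h => by
    simp only [h u (by simp), h v (by simp)]
  have hsub : ({X u, X v} : Finset V) ⊆ A.image X :=
    Finset.insert_subset (Finset.mem_image_of_mem X hu)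
      (Finset.singleton_subset_iff.2 (Finset.mem_image_of_mem X hv))
  rw [coalGen_apply, ← Finset.sum_subset hsub fun z _ hz => ?_, Finset.sum_pair huv]
  · simp only [move, smul_eq_mul, if_true, if_neg huv, if_neg huv.symm, ← Finset.mul_sum, mul_add]
  · have hz' : z ∉ X '' {u, v} := by simpa [Set.image_pair] using hz
    simp [apply_move_of_notMem hdep hz']

end CoalescingWalks

section Matchings

variable {κ V : Type*}

open Classical in
/-- The edges of the complete graph on `A`, as pairs that are ordered by `prec`. -/
def orderedPairs (prec : κ → κ → Prop) (A : Finset κ) : Finset (κ × κ) :=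
  A.offDiag.filter fun e => prec e.1 e.2

/-- The edges in `m` are pairwise disjoint. -/
def IsMatching (m : Finset (κ × κ)) : Prop :=
  (m : Set (κ × κ)).PairwiseDisjoint fun e => ({e.1, e.2} : Set κ)

open Classical in
/-- The matchings of the complete graph on `A`. -/
def matchings (prec : κ → κ → Prop) (A : Finset κ) : Finset (Finset (κ × κ)) :=
  (orderedPairs prec A).powerset.filter IsMatching

/-- The product over the edges of `m` of the weights `a * η`, read at the positions `X`. -/
def matchingWeight (a : ℝ) (η : V → V → ℝ) (m : Finset (κ × κ)) (X : κ → V) : ℝ :=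
  ∏ e ∈ m, a * η (X e.1) (X e.2)

/-- The sum of the weights of all matchings of `A`, which dominates the correlations of the voter
model. -/
def matchingSum (prec : κ → κ → Prop) (a : ℝ) (η : V → V → ℝ) (A : Finset κ) (X : κ → V) : ℝ :=
  ∑ m ∈ matchings prec A, matchingWeight a η m X

/-- A nonnegative kernel, equal to one on the diagonal, that is superharmonic off the diagonal for
two independent walks with jumps uniform on `s`, as the probability that the walks meet is. -/
structure IsMeetingKernel [Add V] (s : Finset V) (η : V → V → ℝ) : Prop where
  nonneg : ∀ u v, 0 ≤ η u v
  diag : ∀ u, η u u = 1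
  superharmonic : ∀ u v, u ≠ v →
    ∑ w ∈ s, (η (u + w) v - η u v) + ∑ w ∈ s, (η u (v + w) - η u v) ≤ 0

variable {prec : κ → κ → Prop} {A A' : Finset κ} {m : Finset (κ × κ)}

theorem mem_orderedPairs {e : κ × κ} :
    e ∈ orderedPairs prec A ↔ e.1 ∈ A ∧ e.2 ∈ A ∧ e.1 ≠ e.2 ∧ prec e.1 e.2 := by
  simp [orderedPairs, and_assoc]

theorem orderedPairs_mono (h : A' ⊆ A) : orderedPairs prec A' ⊆ orderedPairs prec A := by
  intro e he
  obtain ⟨h₁, h₂, hne⟩ := mem_orderedPairs.1 he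
  exact mem_orderedPairs.2 ⟨h h₁, h h₂, hne⟩

theorem mem_matchings : m ∈ matchings prec A ↔ m ⊆ orderedPairs prec A ∧ IsMatching m := by
  simp [matchings]

theorem mem_of_mem_matchings (hm : m ∈ matchings prec A) {e : κ × κ} (he : e ∈ m) :
    e.1 ∈ A ∧ e.2 ∈ A :=
  have h := mem_orderedPairs.1 ((mem_matchings.1 hm).1 he)
  ⟨h.1, h.2.1⟩

theorem matchings_mono (h : A' ⊆ A) : matchings prec A' ⊆ matchings prec A := fun _ hm =>
  mem_matchings.2 ⟨(mem_matchings.1 hm).1.trans (orderedPairs_mono h), (mem_matchings.1 hm).2⟩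

theorem insert_mem_matchings [DecidableEq κ] (h : A' ⊆ A) {e : κ × κ} (he : e ∈ orderedPairs prec A)
    (he₁ : e.1 ∉ A') (he₂ : e.2 ∉ A') (hm : m ∈ matchings prec A') :
    insert e m ∈ matchings prec A := by
  have hm' := mem_matchings.1 (matchings_mono h hm)
  refine mem_matchings.2 ⟨Finset.insert_subset he hm'.1, ?_⟩
  rw [IsMatching, Finset.coe_insert]
  refine hm'.2.insert fun e' he' _ => ?_
  obtain ⟨h₁, h₂⟩ := mem_of_mem_matchings hm he'
  simp only [Set.disjoint_insert_left, Set.disjoint_singleton_left, Set.mem_insert_iff,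
    Set.mem_singleton_iff, not_or]
  exact ⟨⟨(ne_of_mem_of_not_mem h₁ he₁).symm, (ne_of_mem_of_not_mem h₂ he₁).symm⟩,
    (ne_of_mem_of_not_mem h₁ he₂).symm, (ne_of_mem_of_not_mem h₂ he₂).symm⟩

variable {a : ℝ} {η : V → V → ℝ} {X : κ → V}

theorem matchingWeight_nonneg (ha : 0 ≤ a) (hη : ∀ u v, 0 ≤ η u v) (m : Finset (κ × κ))
    (X : κ → V) : 0 ≤ matchingWeight a η m X :=
  Finset.prod_nonneg fun _ _ => mul_nonneg ha (hη _ _)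

theorem matchingWeight_insert [DecidableEq κ] {e : κ × κ} (he : e ∉ m) :
    matchingWeight a η (insert e m) X = a * η (X e.1) (X e.2) * matchingWeight a η m X :=
  Finset.prod_insert he

theorem dependsOn_matchingWeight :
    DependsOn (matchingWeight a η m : (κ → V) → ℝ) (⋃ e ∈ m, ({e.1, e.2} : Set κ)) :=
  fun X Y h => Finset.prod_congr rfl fun e he => by
    rw [h e.1 (Set.mem_biUnion he (by simp)), h e.2 (Set.mem_biUnion he (by simp))]

theorem one_le_matchingSum (ha : 0 ≤ a) (hη : ∀ u v, 0 ≤ η u v) (A : Finset κ) (X : κ → V) :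
    1 ≤ matchingSum prec a η A X := by
  have hempty : ∅ ∈ matchings prec A :=
    mem_matchings.2 ⟨Finset.empty_subset _, by simp [IsMatching]⟩
  simpa [matchingWeight, matchingSum] using
    Finset.single_le_sum (fun m _ => matchingWeight_nonneg ha hη m X) hempty

theorem matchingSum_le_prod (ha : 0 ≤ a) (hη : ∀ u v, 0 ≤ η u v) (A : Finset κ) (X : κ → V) :
    matchingSum prec a η A X ≤ ∏ e ∈ orderedPairs prec A, (1 + a * η (X e.1) (X e.2)) := by
  classical
  rw [Finset.prod_one_add]
  exact Finset.sum_le_sum_of_subset_of_nonneg (Finset.filter_subset _ _)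
    fun m _ _ => matchingWeight_nonneg ha hη m X

/-- The extra factor comes from the matchings that join the two walkers at the same site. -/
theorem one_add_mul_matchingSum_le [DecidableEq κ] [Std.Trichotomous prec] (ha : 0 ≤ a)
    (hη : ∀ u v, 0 ≤ η u v) (hdiag : ∀ u, η u u = 1) (hA : A' ⊆ A) {u v : κ} (hu : u ∈ A \ A')
    (hv : v ∈ A \ A') (huv : u ≠ v) (hX : X u = X v) :
    (1 + a) * matchingSum prec a η A' X ≤ matchingSum prec a η A X := by
  wlog hprec : prec u v generalizing u v
  · have hvu := (trichotomous_of prec u v).resolve_left hprec |>.resolve_left huv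
    exact this hv hu huv.symm hX.symm hvu
  rw [Finset.mem_sdiff] at hu hv
  have hnot : ∀ m ∈ matchings prec A', (u, v) ∉ m := fun m hm he =>
    hu.2 (mem_of_mem_matchings hm he).1
  have hdisj : Disjoint (matchings prec A') ((matchings prec A').image (insert (u, v))) := by
    simp only [Finset.disjoint_left, Finset.mem_image, not_exists, not_and]
    rintro _ hm m' - rfl
    exact hnot _ hm (Finset.mem_insert_self _ _)
  have hinj : Set.InjOn (insert (u, v)) (matchings prec A' : Set (Finset (κ × κ))) :=
    fun m hm m' hm' h => by
      rw [← Finset.erase_insert (hnot m hm), ← Finset.erase_insert (hnot m' hm'), h]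
  have hsub : matchings prec A' ∪ (matchings prec A').image (insert (u, v)) ⊆ matchings prec A :=
    Finset.union_subset (matchings_mono hA) <| Finset.image_subset_iff.2 fun m hm =>
      insert_mem_matchings hA (mem_orderedPairs.2 ⟨hu.1, hv.1, huv, hprec⟩) hu.2 hv.2 hm
  calc (1 + a) * matchingSum prec a η A' X
      = ∑ m ∈ matchings prec A' ∪ (matchings prec A').image (insert (u, v)),
          matchingWeight a η m X := by
        rw [Finset.sum_union hdisj, Finset.sum_image hinj, add_mul, one_mul, matchingSum,
          Finset.mul_sum]
        refine congrArg _ (Finset.sum_congr rfl fun m hm => ?_)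
        rw [matchingWeight_insert (hnot m hm), hX, hdiag, mul_one]
    _ ≤ matchingSum prec a η A X := Finset.sum_le_sum_of_subset_of_nonneg hsub
        fun m _ _ => matchingWeight_nonneg ha hη m X

variable [Add V] [DecidableEq V] {s : Finset V}

theorem coalGen_pair_nonpos (ha : 0 ≤ a) (hη : IsMeetingKernel s η) {u v : κ} (hu : u ∈ A)
    (hv : v ∈ A) (huv : X u ≠ X v) : coalGen s A (fun Y => a * η (Y u) (Y v)) X ≤ 0 := by
  have hsmul : (fun Y : κ → V => a * η (Y u) (Y v)) = a • fun Y => η (Y u) (Y v) := rfl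
  rw [hsmul, map_smul, Pi.smul_apply, smul_eq_mul, coalGen_pair hu hv huv]
  exact mul_nonpos_of_nonneg_of_nonpos ha
    (mul_nonpos_of_nonneg_of_nonpos (by positivity) (hη.superharmonic _ _ huv))

theorem coalGen_matchingWeight_nonpos (ha : 0 ≤ a) (hη : IsMeetingKernel s η)
    (hX : Set.InjOn X A) (hm : m ∈ matchings prec A) :
    coalGen s A (matchingWeight a η m) X ≤ 0 := by
  classical
  obtain ⟨hmA, hmatch⟩ := mem_matchings.1 hm
  clear hm
  induction m using Finset.induction_on with
  | empty => simp [coalGen_apply, matchingWeight]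
  | insert e m he ih =>
    rw [IsMatching, Finset.coe_insert, Set.pairwiseDisjoint_insert_of_notMem (by simpa using he)]
      at hmatch
    obtain ⟨heA, hmA⟩ := Finset.insert_subset_iff.1 hmA
    obtain ⟨h₁, h₂, hne, -⟩ := mem_orderedPairs.1 heA
    have hpair : DependsOn (fun Y : κ → V => a * η (Y e.1) (Y e.2)) {e.1, e.2} := fun Y Z h => by
      simp only [h e.1 (by simp), h e.2 (by simp)]
    have hsub : ∀ e ∈ orderedPairs prec A, ({e.1, e.2} : Set κ) ⊆ A := fun e he =>
      Set.pair_subset (mem_orderedPairs.1 he).1 (mem_orderedPairs.1 he).2.1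
    have hdisj : Disjoint (X '' {e.1, e.2}) (X '' ⋃ e' ∈ m, {e'.1, e'.2}) := by
      rw [Set.disjoint_iff_inter_eq_empty, ← hX.image_inter (hsub e heA)
        (Set.iUnion₂_subset fun e' he' => hsub e' (hmA he')), Set.image_eq_empty,
        ← Set.disjoint_iff_inter_eq_empty]
      exact Set.disjoint_iUnion₂_right.2 hmatch.2
    have hmul : (matchingWeight a η (insert e m) : (κ → V) → ℝ)
        = (fun Y => a * η (Y e.1) (Y e.2)) * matchingWeight a η m :=
      funext fun Y => matchingWeight_insert he
    rw [hmul, coalGen_mul_of_disjoint hpair dependsOn_matchingWeight hdisj]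
    exact add_nonpos
      (mul_nonpos_of_nonpos_of_nonneg (coalGen_pair_nonpos ha hη h₁ h₂ fun h => hne (hX h₁ h₂ h))
        (matchingWeight_nonneg ha hη.nonneg m X))
      (mul_nonpos_of_nonneg_of_nonpos (mul_nonneg ha (hη.nonneg _ _)) (ih hmA hmatch.1))

theorem coalGen_matchingSum_nonpos (ha : 0 ≤ a) (hη : IsMeetingKernel s η)
    (hX : Set.InjOn X A) : coalGen s A (matchingSum prec a η A) X ≤ 0 := by
  have hsum : (matchingSum prec a η A : (κ → V) → ℝ)
      = ∑ m ∈ matchings prec A, matchingWeight a η m := by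
    funext Y
    rw [matchingSum, Finset.sum_apply]
  rw [hsum, map_sum, Finset.sum_apply]
  exact Finset.sum_nonpos fun m hm => coalGen_matchingWeight_nonpos ha hη hX hm

end Matchings

/-! ### Duality between the voter model and coalescing walks -/

section Duality

variable {d R : ℕ}

theorem ball1_finite (d R : ℕ) : (ball1 d R).Finite := by
  refine (Set.finite_Icc (fun _ => -(R : ℤ)) (fun _ => (R : ℤ))).subset fun x hx => ?_
  have h : ∀ i, (x i).natAbs ≤ R := fun i =>
    (Finset.single_le_sum (fun _ _ => Nat.zero_le _) (Finset.mem_univ i)).trans hx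
  exact ⟨fun i => by grind, fun i => by grind⟩

/-- The possible jumps of an `R`-spread-out walk. -/
def steps (d R : ℕ) : Finset (Site d) := (ball1_finite d R).toFinset.erase 0

theorem l1_neg (x : Site d) : l1 (-x) = l1 x := by simp [l1]

theorem mem_steps {w : Site d} : w ∈ steps d R ↔ 0 < l1 w ∧ l1 w ≤ R := by
  have h : l1 w = 0 ↔ w = 0 := by simp [l1, funext_iff]
  simp [steps, ball1, Nat.pos_iff_ne_zero, h]

theorem coe_steps (d R : ℕ) : (steps d R : Set (Site d)) = ball1 d R \ {0} := by
  ext; simp [steps]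

theorem card_steps (d R : ℕ) : ((steps d R).card : ℝ) = (ball1 d R).ncard - 1 := by
  have h0 : (0 : Site d) ∈ (ball1_finite d R).toFinset := by simp [ball1, l1]
  rw [steps, Finset.cast_card_erase_of_mem h0, Set.ncard_eq_toFinset_card _ (ball1_finite d R)]

theorem steps_nonempty (hd : 0 < d) (hR : 1 ≤ R) : (steps d R).Nonempty := by
  refine ⟨Pi.single ⟨0, hd⟩ 1, mem_steps.2 ?_⟩
  have h : l1 (Pi.single (⟨0, hd⟩ : Fin d) (1 : ℤ)) = 1 := by
    rw [l1, Finset.sum_eq_single ⟨0, hd⟩] <;> simp +contextual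
  omega

variable {κ : Type*}

/-- Reading a configuration at the positions `X`. -/
def relabel (X : κ → Site d) : C(Config d, κ → Bool) :=
  ⟨fun ξ => ξ ∘ X, by fun_prop⟩

theorem relabel_copy (X : κ → Site d) (ξ : Config d) (y z : Site d) :
    relabel X (copy ξ y z) = relabel (move X z y) ξ := by
  funext i
  by_cases h : X i = z <;> simp [relabel, copy, move, h]

variable {A : Finset κ} {f : C(κ → Bool, ℝ)}

theorem dependsOn_comp_relabel (hf : DependsOn f (A : Set κ)) (X : κ → Site d) :
    DependsOn (f.comp (relabel X)) (A.image X : Set (Site d)) := fun _ _ h =>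
  hf fun _ hi => h _ (Finset.mem_coe.2 (Finset.mem_image_of_mem X hi))

/-- Duality: a voter that copies the state of a neighbour moves the walkers that read its state to
that neighbour. -/
theorem pregenerator_comp_relabel (hf : DependsOn f (A : Set κ)) (R : ℕ) (X : κ → Site d) :
    pregenerator d R (f.comp (relabel X))
      = coalGen (steps d R) A (fun Y => f.comp (relabel Y)) X := by
  classical
  funext ξ
  have hinj : Set.InjOn (fun p : Site d × Site d => (p.1, p.1 + p.2))
      (A.image X ×ˢ steps d R : Finset (Site d × Site d)) := by
    rintro ⟨z, w⟩ - ⟨z', w'⟩ - h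
    obtain ⟨rfl, h⟩ := Prod.mk.inj h
    exact Prod.ext rfl (add_left_cancel h)
  rw [pregenerator, tsum_eq_sum (s := (A.image X ×ˢ steps d R).image fun p => (p.1, p.1 + p.2)),
    Finset.sum_image hinj, Finset.sum_product, coalGen_apply]
  · simp only [ContinuousMap.sum_apply]
    refine Finset.sum_congr rfl fun z _ => Finset.sum_congr rfl fun w hw => ?_
    have hrange : 0 < l1 (z - (z + w)) ∧ l1 (z - (z + w)) ≤ R := by
      rw [sub_add_cancel_left, l1_neg]
      exact mem_steps.1 hw
    rw [if_pos hrange, ← card_steps]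
    simp [relabel_copy, div_eq_inv_mul]
  · rintro ⟨z, y⟩ hp
    refine ite_eq_right_iff.2 fun hrange => ?_
    have hz : z ∉ A.image X := fun hz => hp <| Finset.mem_image.2 ⟨(z, y - z),
      Finset.mem_product.2 ⟨hz, mem_steps.2 (by rwa [← l1_neg, neg_sub])⟩, by simp⟩
    have hcopy : f.comp (relabel X) (copy ξ y z) = f.comp (relabel X) ξ :=
      dependsOn_comp_relabel hf X fun u hu =>
        Function.update_of_ne (ne_of_mem_of_not_mem (Finset.mem_coe.1 hu) hz) _ _
    rw [hcopy, sub_self, zero_div]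

variable {S : ℝ≥0 → C(Config d, ℝ) →ₗ[ℝ] C(Config d, ℝ)}

theorem hasDerivWithinAt_comp_relabel (hS : IsVoterSemigroup d R S)
    (hf : DependsOn f (A : Set κ)) (Λ : C(Config d, ℝ) →L[ℝ] ℝ) (X : κ → Site d) (t : ℝ≥0) :
    HasDerivWithinAt (fun s : ℝ => Λ (S s.toNNReal (f.comp (relabel X))))
      (coalGen (steps d R) A (fun Y => Λ (S t (f.comp (relabel Y)))) X) (Set.Ici (t : ℝ)) t := by
  have hgen : Tendsto (fun h : ℝ≥0 => (h : ℝ)⁻¹ • (S h (f.comp (relabel X)) - f.comp (relabel X)))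
      (𝓝[>] 0) (𝓝 (coalGen (steps d R) A (fun Y => f.comp (relabel Y)) X)) := by
    rw [ContinuousMap.tendsto_iff_tendstoUniformly, ← pregenerator_comp_relabel hf]
    simpa [Function.comp_def, div_eq_inv_mul] using
      hS.generator _ _ (dependsOn_comp_relabel hf X)
  have hcomm : Λ (S t (coalGen (steps d R) A (fun Y => f.comp (relabel Y)) X))
      = coalGen (steps d R) A (fun Y => Λ (S t (f.comp (relabel Y)))) X :=
    map_coalGen (Λ.toLinearMap ∘ₗ S t) _ X
  rw [← hcomm]
  exact Λ.hasFDerivAt.comp_hasDerivWithinAt (t : ℝ) (hS.markov.hasDerivWithinAt hgen t)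

theorem apply_comp_relabel_le (hS : IsVoterSemigroup d R S) (hf : DependsOn f (A : Set κ))
    (Λ : C(Config d, ℝ) →L[ℝ] ℝ) {W : (κ → Site d) → ℝ} (hW₀ : ∀ X, 0 ≤ W X)
    (hW : ∀ X, (∀ t, Λ (S t (f.comp (relabel X))) ≤ W X) ∨
      coalGen (steps d R) A W X ≤ 0 ∧ Λ (f.comp (relabel X)) ≤ W X)
    (X : κ → Site d) (t : ℝ≥0) : Λ (S t (f.comp (relabel X))) ≤ W X := by
  have hnorm : ∀ X : κ → Site d, ‖f.comp (relabel X)‖ ≤ ‖f‖ := fun X =>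
    (ContinuousMap.norm_le _ (norm_nonneg f)).2 fun ξ => f.norm_coe_le_norm _
  have hbound : ∀ (X : κ → Site d) (t : ℝ≥0), Λ (S t (f.comp (relabel X))) ≤ ‖Λ‖ * ‖f‖ :=
    fun X t => (le_abs_self _).trans <| (Λ.le_opNorm _).trans <| by
      gcongr
      exact (hS.markov.norm_apply_le t _).trans (hnorm X)
  have hrate : ∀ (φ : (κ → Site d) → ℝ) (K : ℝ), (∀ Y, φ Y ≤ K) → ∀ X,
      coalGen (steps d R) A φ X ≤ (A.card + 1 : ℝ) * (K - φ X) := fun φ K hφ X => by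
    linarith [coalGen_le (s := steps d R) (A := A) hφ X, hφ X]
  simpa using comparison_principle (L := coalGen (steps d R) A) (C := A.card + 1)
    (g := fun X s => Λ (S s.toNNReal (f.comp (relabel X)))) (M := ‖Λ‖ * ‖f‖) (by positivity) hrate
    (fun X => (Λ.continuous.comp <|
      (hS.markov.continuous _).comp continuous_real_toNNReal).continuousOn)
    (fun X s hs => by
      lift s to ℝ≥0 using hs
      simpa using hasDerivWithinAt_comp_relabel hS hf Λ X s)
    (fun X => (hW X).imp (fun h s _ => h _) fun h => by simpa [hS.markov.zero] using h)
    (fun X s _ => by linarith [hbound X s.toNNReal, hW₀ X]) X t.2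

end Duality

/-! ### Spread-out walks and their meeting probability -/

instance : IsProbabilityMeasure (expMeasure 1) := isProbabilityMeasure_expMeasure one_pos

theorem map_sub_restrict_expMeasure (r : ℝ) {s : ℝ} (hs : 0 ≤ s) :
    ((expMeasure r).restrict (Set.Ioi s)).map (· - s)
      = ENNReal.ofReal (Real.exp (-(r * s))) • expMeasure r := by
  ext A hA
  have hexp : expMeasure r = volume.withDensity (exponentialPDF r) := rfl
  have hm : Measurable (exponentialPDF r) := (measurable_exponentialPDFReal r).ennreal_ofReal
  have hpre : MeasurableSet ((· - s) ⁻¹' A) := (measurable_id.sub_const s) hA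
  rw [Measure.map_apply (by fun_prop) hA, Measure.restrict_apply hpre, Measure.smul_apply, hexp,
    withDensity_apply _ (hpre.inter measurableSet_Ioi), withDensity_apply _ hA, smul_eq_mul,
    ← lintegral_indicator (hpre.inter measurableSet_Ioi), ← lintegral_indicator hA,
    ← lintegral_const_mul _ (hm.indicator hA), ← lintegral_add_right_eq_self _ s]
  refine lintegral_congr_ae ?_
  filter_upwards [compl_mem_ae_iff.2 (measure_singleton (0 : ℝ))] with t (ht : t ≠ 0)
  by_cases htA : t ∈ A
  · rcases ht.lt_or_gt with h | h
    · simp [Set.indicator, h.not_gt, exponentialPDF_of_neg h]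
    · simp only [Set.indicator, Set.mem_inter_iff, Set.mem_preimage, add_sub_cancel_right, htA,
        Set.mem_Ioi, lt_add_iff_pos_left, h, and_self, if_true,
        exponentialPDF_of_nonneg (add_nonneg h.le hs), exponentialPDF_of_nonneg h.le]
      rw [← ENNReal.ofReal_mul (Real.exp_pos _).le, mul_left_comm, ← Real.exp_add]
      ring_nf
  · simp [Set.indicator, htA]

theorem lintegral_exp_neg_expMeasure :
    ∫⁻ s, ENNReal.ofReal (Real.exp (-s)) ∂(expMeasure 1) = 2⁻¹ := by
  have hexp : expMeasure 1 = volume.withDensity (exponentialPDF 1) := rfl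
  have hm : ∀ r, Measurable (exponentialPDF r) := fun r =>
    (measurable_exponentialPDFReal r).ennreal_ofReal
  have hpdf : ∀ s, exponentialPDF 1 s * ENNReal.ofReal (Real.exp (-s))
      = 2⁻¹ * exponentialPDF 2 s := fun s => by
    rcases lt_or_ge s 0 with h | h
    · simp [exponentialPDF_of_neg h]
    · have h2 : (2⁻¹ : ENNReal) = ENNReal.ofReal 2⁻¹ := by
        rw [ENNReal.ofReal_inv_of_pos two_pos, ENNReal.ofReal_ofNat]
      rw [exponentialPDF_of_nonneg h, exponentialPDF_of_nonneg h, h2,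
        ← ENNReal.ofReal_mul (by positivity), ← ENNReal.ofReal_mul (by positivity), one_mul,
        ← Real.exp_add, inv_mul_cancel_left₀ two_ne_zero]
      ring_nf
  rw [hexp, lintegral_withDensity_eq_lintegral_mul _ (hm 1) (by fun_prop)]
  simp only [Pi.mul_apply, hpdf]
  rw [lintegral_const_mul _ (hm 2), lintegral_exponentialPDF_eq_one two_pos, mul_one]

theorem ae_pos_expMeasure (r : ℝ) : ∀ᵐ s ∂(expMeasure r), 0 < s := by
  have hexp : expMeasure r = volume.withDensity (exponentialPDF r) := rfl
  have hset : {s : ℝ | ¬ 0 < s} = Set.Iic 0 := by ext; simp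
  rw [ae_iff, hexp, hset, withDensity_apply _ measurableSet_Iic,
    setLIntegral_congr Iio_ae_eq_Iic.symm]
  exact lintegral_exponentialPDF_of_nonpos le_rfl

/-- The sequence with first term `x` followed by `ω`. -/
def consSeq {α : Type*} (x : α) (ω : ℕ → α) : ℕ → α
  | 0 => x
  | k + 1 => ω k

theorem measurable_consSeq {α : Type*} [MeasurableSpace α] :
    Measurable fun p : α × (ℕ → α) => consSeq p.1 p.2 := by
  refine measurable_pi_lambda _ fun k => ?_
  cases k with
  | zero => exact measurable_fst
  | succ k => exact (measurable_pi_apply k).comp measurable_snd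

theorem eq_infinitePi_of_range {α : Type*} [MeasurableSpace α] {ν : Measure α}
    [IsProbabilityMeasure ν] {m : Measure (ℕ → α)}
    (h : ∀ (n : ℕ) (t : ℕ → Set α), (∀ i, MeasurableSet (t i)) →
      m ((Finset.range n : Set ℕ).pi t) = ∏ i ∈ Finset.range n, ν (t i)) :
    m = Measure.infinitePi fun _ => ν := by
  classical
  refine Measure.eq_infinitePi _ fun s t ht => ?_
  obtain ⟨n, hn⟩ := s.exists_nat_subset_range
  let t' : ℕ → Set α := fun i => if i ∈ s then t i else Set.univ
  have hpi : (s : Set ℕ).pi t = (Finset.range n : Set ℕ).pi t' := by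
    ext ω
    refine ⟨fun h i _ => ?_, fun h i hi => by simpa [t', Finset.mem_coe.1 hi] using h i (hn hi)⟩
    by_cases hi : i ∈ s
    · simpa [t', hi] using h i hi
    · simp [t', hi]
  rw [hpi, h n t' fun i => by by_cases hi : i ∈ s <;> simp [t', hi, ht],
    ← Finset.prod_subset hn fun i _ hi => by simp [t', hi]]
  exact Finset.prod_congr rfl fun i hi => by simp [t', hi]

theorem map_consSeq {α : Type*} [MeasurableSpace α] (ν : Measure α) [IsProbabilityMeasure ν] :
    (ν.prod (Measure.infinitePi fun _ : ℕ => ν)).map (fun p => consSeq p.1 p.2)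
      = Measure.infinitePi fun _ : ℕ => ν := by
  refine eq_infinitePi_of_range fun n t ht => ?_
  rw [Measure.map_apply measurable_consSeq (.pi (Set.to_countable _) fun i _ => ht i)]
  cases n with
  | zero => simp
  | succ n =>
    have hpre : (fun p : α × (ℕ → α) => consSeq p.1 p.2) ⁻¹'
        (Finset.range (n + 1) : Set ℕ).pi t
        = t 0 ×ˢ (Finset.range n : Set ℕ).pi fun i => t (i + 1) := by
      ext p
      simp only [Set.mem_preimage, Set.mem_pi, Finset.mem_coe, Finset.mem_range,
        Nat.forall_lt_succ_left, Set.mem_prod]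
      rfl
    rw [hpre, Measure.prod_prod, Measure.infinitePi_pi _ fun i _ => ht _,
      Finset.prod_range_succ', mul_comm]

section Walk

variable {d R : ℕ}

theorem lintegral_uniformOn_steps (g : Site d → ENNReal) :
    ∫⁻ w, g w ∂(uniformOn (ball1 d R \ {0})) = ((steps d R).card : ENNReal)⁻¹ *
      ∑ w ∈ steps d R, g w := by
  rw [← coe_steps, uniformOn, ProbabilityTheory.cond, lintegral_smul_measure,
    Measure.count_apply_finset, lintegral_finset]
  simp only [smul_eq_mul, Measure.count_singleton, mul_one]

/-- `advance s ω` is the walk `ω` seen from time `s` on, for `s` before the first jump: the first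
holding time is shortened by `s`. -/
def advance (s : ℝ) (ω : ℕ → ℝ × Site d) : ℕ → ℝ × Site d :=
  consSeq ((ω 0).1 - s, (ω 0).2) fun k => ω (k + 1)

theorem measurable_advance : Measurable fun p : ℝ × (ℕ → ℝ × Site d) => advance p.1 p.2 :=
  measurable_consSeq.comp (Measurable.prodMk (by fun_prop) (by fun_prop))

theorem advance_snd (s : ℝ) (ω : ℕ → ℝ × Site d) (k : ℕ) : (advance s ω k).2 = (ω k).2 := by
  cases k <;> rfl

theorem sum_advance (s : ℝ) (ω : ℕ → ℝ × Site d) (m : ℕ) :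
    ∑ k ∈ Finset.range (m + 1), (advance s ω k).1 = ∑ k ∈ Finset.range (m + 1), (ω k).1 - s := by
  rw [Finset.sum_range_succ', Finset.sum_range_succ', add_sub_assoc]
  rfl

/-- The walk driven by `ω` has made exactly `m` jumps up to time `t`. Unlike `jumpCount ω t = m`,
this fails for all `m` if the walk makes infinitely many jumps up to time `t`. -/
def HasJumped (ω : ℕ → ℝ × Site d) (t : ℝ) (m : ℕ) : Prop :=
  t < ∑ k ∈ Finset.range (m + 1), (ω k).1 ∧ ∀ j < m, ∑ k ∈ Finset.range (j + 1), (ω k).1 ≤ t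

theorem HasJumped.jumpCount_eq {ω : ℕ → ℝ × Site d} {t : ℝ} {m : ℕ} (h : HasJumped ω t m) :
    jumpCount ω t = m :=
  le_antisymm (Nat.sInf_le h.1) <| le_csInf ⟨m, h.1⟩ fun j hj =>
    le_of_not_gt fun hjm => hj.not_ge (h.2 j hjm)

theorem HasJumped.exists_right {ω : ℕ → ℝ × Site d} {t : ℝ} {m : ℕ} (h : HasJumped ω t m) :
    ∃ b, t < b ∧ ∀ s, t ≤ s → s < b → HasJumped ω s m :=
  ⟨_, h.1, fun _ hs hb => ⟨hb, fun j hj => (h.2 j hj).trans hs⟩⟩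

theorem HasJumped.of_tail {ω : ℕ → ℝ × Site d} {t : ℝ} {m : ℕ} (ht : 0 ≤ t)
    (h : HasJumped (fun k => ω (k + 1)) t m) : HasJumped ω (t + (ω 0).1) (m + 1) := by
  refine ⟨?_, fun j hj => ?_⟩ <;> rw [Finset.sum_range_succ']
  · linarith [h.1]
  · cases j with
    | zero => simpa using ht
    | succ j => linarith [h.2 j (by omega)]

theorem HasJumped.of_advance {ω : ℕ → ℝ × Site d} {s t : ℝ} {m : ℕ}
    (h : HasJumped (advance s ω) t m) : HasJumped ω (t + s) m := by
  simp only [HasJumped, sum_advance] at h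
  exact ⟨by linarith [h.1], fun j hj => by linarith [h.2 j hj]⟩

theorem measurableSet_hasJumped (t : ℝ) (m : ℕ) :
    MeasurableSet {ω : ℕ → ℝ × Site d | HasJumped ω t m} := by
  have hsum : ∀ j : ℕ, Measurable fun ω : ℕ → ℝ × Site d =>
      ∑ k ∈ Finset.range (j + 1), (ω k).1 := fun j => by fun_prop
  simp only [HasJumped, Set.ofPred_and, Set.ofPred_forall]
  exact (measurableSet_lt measurable_const (hsum m)).inter <| .iInter fun j => .iInter fun _ =>
    measurableSet_le (hsum j) measurable_const

/-- The walks started at `u` and `v` meet after finitely many jumps of both. -/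
def meetSet (u v : Site d) : Set ((ℕ → ℝ × Site d) × (ℕ → ℝ × Site d)) :=
  {p | ∃ t : ℝ, 0 ≤ t ∧ ∃ m k, HasJumped p.1 t m ∧ HasJumped p.2 t k ∧
    u + ∑ j ∈ Finset.range m, (p.1 j).2 = v + ∑ j ∈ Finset.range k, (p.2 j).2}

theorem meetSet_subset (u v : Site d) :
    meetSet u v ⊆ {p | ∃ t : ℝ, 0 ≤ t ∧ walk u p.1 t = walk v p.2 t} := by
  rintro p ⟨t, ht, m, k, hm, hk, h⟩
  exact ⟨t, ht, by rw [walk, walk, hm.jumpCount_eq, hk.jumpCount_eq, h]⟩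

theorem preimage_swap_meetSet (u v : Site d) : Prod.swap ⁻¹' meetSet v u = meetSet u v := by
  ext p
  constructor <;>
  · rintro ⟨t, ht, m, k, hm, hk, h⟩
    exact ⟨t, ht, k, m, hk, hm, h.symm⟩

theorem measurableSet_setOf_mem_meetSet :
    MeasurableSet {q : Site d × Site d × (ℕ → ℝ × Site d) × (ℕ → ℝ × Site d) |
      q.2.2 ∈ meetSet q.1 q.2.1} := by
  -- The paths are right continuous, so that a meeting persists until some rational time.
  have hrat : {q : Site d × Site d × (ℕ → ℝ × Site d) × (ℕ → ℝ × Site d) |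
        q.2.2 ∈ meetSet q.1 q.2.1}
      = ⋃ r : ℚ, ⋃ m : ℕ, ⋃ k : ℕ, {q | 0 ≤ (r : ℝ) ∧ HasJumped q.2.2.1 r m ∧
          HasJumped q.2.2.2 r k ∧ q.1 + ∑ j ∈ Finset.range m, (q.2.2.1 j).2
            = q.2.1 + ∑ j ∈ Finset.range k, (q.2.2.2 j).2} := by
    ext q
    simp only [Set.mem_iUnion]
    constructor
    · rintro ⟨t, ht, m, k, hm, hk, h⟩
      obtain ⟨b, hb, hmb⟩ := hm.exists_right
      obtain ⟨c, hc, hkc⟩ := hk.exists_right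
      obtain ⟨r, htr, hr⟩ := exists_rat_btwn (lt_min hb hc)
      exact ⟨r, m, k, ht.trans htr.le, hmb r htr.le (hr.trans_le (min_le_left _ _)),
        hkc r htr.le (hr.trans_le (min_le_right _ _)), h⟩
    · rintro ⟨r, m, k, hr, hm, hk, h⟩
      exact ⟨r, hr, m, k, hm, hk, h⟩
  rw [hrat]
  exact .iUnion fun r => .iUnion fun m => .iUnion fun k => (MeasurableSet.const _).inter <|
    ((measurableSet_hasJumped _ _).preimage (by fun_prop)).inter <|
    ((measurableSet_hasJumped _ _).preimage (by fun_prop)).inter <|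
    measurableSet_eq_fun (by fun_prop) (by fun_prop)

theorem measurableSet_meetSet (u v : Site d) : MeasurableSet (meetSet u v) :=
  measurableSet_setOf_mem_meetSet.preimage
    (f := fun p : (ℕ → ℝ × Site d) × (ℕ → ℝ × Site d) => (u, v, p)) (by fun_prop)

/-- The first walk jumps before the second one, and the walks meet afterwards. -/
def firstJumpSet (u v : Site d) : Set ((ℕ → ℝ × Site d) × (ℕ → ℝ × Site d)) :=
  {p | (0 ≤ (p.1 0).1 ∧ (p.1 0).1 < (p.2 0).1) ∧
    (fun k => p.1 (k + 1), advance (p.1 0).1 p.2) ∈ meetSet (u + (p.1 0).2) v}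

theorem firstJumpSet_subset (u v : Site d) : firstJumpSet u v ⊆ meetSet u v := by
  rintro p ⟨⟨h0, -⟩, t, ht, m, k, hm, hk, h⟩
  refine ⟨t + (p.1 0).1, add_nonneg ht h0, m + 1, k, hm.of_tail ht, hk.of_advance, ?_⟩
  simp only [advance_snd] at h
  rw [Finset.sum_range_succ', ← h]
  abel

theorem measurableSet_firstJumpSet (u v : Site d) : MeasurableSet (firstJumpSet u v) := by
  have h1 : Measurable fun p : (ℕ → ℝ × Site d) × (ℕ → ℝ × Site d) => (p.1 0).1 := by fun_prop
  have h2 : Measurable fun p : (ℕ → ℝ × Site d) × (ℕ → ℝ × Site d) => (p.2 0).1 := by fun_prop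
  have h : Measurable fun p : (ℕ → ℝ × Site d) × (ℕ → ℝ × Site d) =>
      (u + (p.1 0).2, v, (fun k => p.1 (k + 1)), advance (p.1 0).1 p.2) := by
    refine .prodMk (by fun_prop) (.prodMk (by fun_prop) (.prodMk (by fun_prop) ?_))
    exact measurable_advance.comp (h1.prodMk measurable_snd)
  exact ((measurableSet_le measurable_const h1).inter (measurableSet_lt h1 h2)).inter
    (measurableSet_setOf_mem_meetSet.preimage h)

/-- The law of the driving randomness of two independent walks. -/
abbrev walkPairMeasure (d R : ℕ) : Measure ((ℕ → ℝ × Site d) × (ℕ → ℝ × Site d)) :=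
  (walkMeasure d R).prod (walkMeasure d R)

/-- The probability that the walks started at `u` and `v` meet after finitely many jumps. In
`meetProb R u v`, meetings on the null event of explosion would count as well. -/
def meetKernel (R : ℕ) (u v : Site d) : ℝ := (walkPairMeasure d R).real (meetSet u v)

variable [Nonempty (steps d R)]

instance : IsProbabilityMeasure (uniformOn (ball1 d R \ {0})) := by
  rw [← coe_steps]
  exact isProbabilityMeasure_uniformOn (steps d R).finite_toSet
    (Finset.nonempty_coe_sort.1 inferInstance)

instance : IsProbabilityMeasure (walkMeasure d R) := by
  unfold walkMeasure
  infer_instance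

theorem map_consSeq_walkMeasure :
    (((expMeasure 1).prod (uniformOn (ball1 d R \ {0}))).prod (walkMeasure d R)).map
      (fun p => consSeq p.1 p.2) = walkMeasure d R :=
  map_consSeq _

theorem map_advance_walkMeasure {s : ℝ} (hs : 0 ≤ s) :
    ((walkMeasure d R).restrict {ω | s < (ω 0).1}).map (advance s)
      = ENNReal.ofReal (Real.exp (-s)) • walkMeasure d R := by
  have hset : MeasurableSet {ω : ℕ → ℝ × Site d | s < (ω 0).1} :=
    measurableSet_lt measurable_const (by fun_prop)
  have hadv : Measurable (advance (d := d) s) := measurable_advance.comp measurable_prodMk_left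
  have hpre : (fun p : (ℝ × Site d) × (ℕ → ℝ × Site d) => consSeq p.1 p.2) ⁻¹'
      {ω | s < (ω 0).1} = (Set.Ioi s ×ˢ Set.univ) ×ˢ Set.univ := by
    ext p; simp [consSeq]
  have hcomp : (advance s ∘ fun p : (ℝ × Site d) × (ℕ → ℝ × Site d) => consSeq p.1 p.2)
      = (fun p => consSeq p.1 p.2) ∘ Prod.map (Prod.map (· - s) id) id := rfl
  conv_lhs => rw [← map_consSeq_walkMeasure]
  rw [Measure.restrict_map measurable_consSeq hset, Measure.map_map hadv measurable_consSeq, hpre,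
    hcomp, ← Measure.map_map measurable_consSeq (by fun_prop), ← Measure.prod_restrict,
    ← Measure.prod_restrict, Measure.restrict_univ, Measure.restrict_univ,
    ← Measure.map_prod_map _ _ (by fun_prop) measurable_id,
    ← Measure.map_prod_map _ _ (by fun_prop) measurable_id, Measure.map_id, Measure.map_id,
    map_sub_restrict_expMeasure 1 hs, one_mul, Measure.prod_smul_left, Measure.prod_smul_left,
    Measure.map_smul, map_consSeq_walkMeasure]

theorem measure_firstJumpSet_slice {s : ℝ} (hs : 0 ≤ s) (u v w : Site d)
    (ω : ℕ → ℝ × Site d) :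
    walkMeasure d R (Prod.mk (consSeq (s, w) ω) ⁻¹' firstJumpSet u v)
      = ENNReal.ofReal (Real.exp (-s)) * walkMeasure d R (Prod.mk ω ⁻¹' meetSet (u + w) v) := by
  have hadv : Measurable (advance (d := d) s) := measurable_advance.comp measurable_prodMk_left
  have hmeet := measurable_prodMk_left (x := ω) (measurableSet_meetSet (u + w) v)
  have hslice : Prod.mk (consSeq (s, w) ω) ⁻¹' firstJumpSet u v
      = advance s ⁻¹' (Prod.mk ω ⁻¹' meetSet (u + w) v) ∩ {ω' | s < (ω' 0).1} := by
    ext ω'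
    exact ⟨fun h => ⟨h.2, h.1.2⟩, fun h => ⟨⟨hs, h.2⟩, h.1⟩⟩
  rw [hslice, ← Measure.restrict_apply (hadv hmeet), ← Measure.map_apply hadv hmeet,
    map_advance_walkMeasure hs, Measure.smul_apply, smul_eq_mul]

theorem measure_firstJumpSet (u v : Site d) :
    walkPairMeasure d R (firstJumpSet u v) = 2⁻¹ * (((steps d R).card : ENNReal)⁻¹ *
      ∑ w ∈ steps d R, walkPairMeasure d R (meetSet (u + w) v)) := by
  have hmeas := measurableSet_firstJumpSet u v
  have hcons : Measurable fun p : (ℝ × Site d) × (ℕ → ℝ × Site d) =>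
      walkMeasure d R (Prod.mk (consSeq p.1 p.2) ⁻¹' firstJumpSet u v) :=
    (measurable_measure_prodMk_left hmeas).comp measurable_consSeq
  have hslice : ∀ s, 0 < s → ∀ w, ∫⁻ ω, walkMeasure d R
      (Prod.mk (consSeq (s, w) ω) ⁻¹' firstJumpSet u v) ∂(walkMeasure d R)
      = ENNReal.ofReal (Real.exp (-s)) * walkPairMeasure d R (meetSet (u + w) v) :=
    fun s hs w => by
      have hmeet := measurableSet_meetSet (u + w) v
      simp only [measure_firstJumpSet_slice hs.le]
      rw [lintegral_const_mul _ (measurable_measure_prodMk_left hmeet), Measure.prod_apply hmeet]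
  have hmap := lintegral_map (μ := ((expMeasure 1).prod (uniformOn (ball1 d R \ {0}))).prod
    (walkMeasure d R)) (measurable_measure_prodMk_left (ν := walkMeasure d R) hmeas)
    measurable_consSeq
  rw [map_consSeq_walkMeasure] at hmap
  rw [Measure.prod_apply hmeas, hmap, lintegral_prod _ hcons.aemeasurable,
    lintegral_prod _ hcons.lintegral_prod_right'.aemeasurable,
    ← lintegral_exp_neg_expMeasure, ← lintegral_mul_const _ (by fun_prop)]
  refine lintegral_congr_ae ?_
  filter_upwards [ae_pos_expMeasure 1] with s hs
  simp only [hslice s hs, lintegral_uniformOn_steps, ← Finset.mul_sum]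
  ring

theorem measureReal_firstJumpSet (u v : Site d) :
    (walkPairMeasure d R).real (firstJumpSet u v)
      = (∑ w ∈ steps d R, meetKernel R (u + w) v) / (2 * (steps d R).card) := by
  rw [measureReal_def, measure_firstJumpSet, ENNReal.toReal_mul, ENNReal.toReal_mul,
    ENNReal.toReal_sum fun _ _ => measure_ne_top _ _]
  simp only [ENNReal.toReal_inv, ENNReal.toReal_ofNat, ENNReal.toReal_natCast, meetKernel,
    measureReal_def]
  rw [← mul_assoc, ← mul_inv, div_eq_inv_mul]

theorem meetKernel_comm (u v : Site d) : meetKernel R u v = meetKernel R v u := by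
  rw [meetKernel, meetKernel, ← preimage_swap_meetSet]
  exact Measure.measurePreserving_swap.measureReal_preimage
    (measurableSet_meetSet v u).nullMeasurableSet

theorem meetKernel_le_meetProb (u v : Site d) : meetKernel R u v ≤ meetProb R u v :=
  measureReal_mono (meetSet_subset u v)

theorem meetKernel_self (u : Site d) : meetKernel R u u = 1 := by
  have hpos : ∀ᵐ ω ∂(walkMeasure d R), 0 < (ω 0).1 :=
    (measurePreserving_eval_infinitePi (fun _ : ℕ =>
      (expMeasure 1).prod (uniformOn (ball1 d R \ {0}))) 0).quasiMeasurePreserving.ae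
      (Measure.quasiMeasurePreserving_fst.ae (ae_pos_expMeasure 1))
  have hmeet : ∀ᵐ p ∂(walkPairMeasure d R), p ∈ meetSet u u := by
    filter_upwards [Measure.quasiMeasurePreserving_fst.ae hpos,
      Measure.quasiMeasurePreserving_snd.ae hpos] with p h1 h2
    exact ⟨0, le_rfl, 0, 0, ⟨by simpa using h1, by simp⟩, ⟨by simpa using h2, by simp⟩, by simp⟩
  rw [meetKernel, measureReal_def, prob_compl_eq_zero_iff (measurableSet_meetSet u u) |>.1 hmeet,
    ENNReal.toReal_one]

theorem measureReal_firstJumpSet_add_le (u v : Site d) :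
    (walkPairMeasure d R).real (firstJumpSet u v)
      + (walkPairMeasure d R).real (firstJumpSet v u) ≤ meetKernel R u v := by
  have hdisj : Disjoint (firstJumpSet u v) (Prod.swap ⁻¹' firstJumpSet v u) :=
    Set.disjoint_left.2 fun p h1 h2 => lt_asymm h1.1.2 h2.1.2
  rw [← Measure.measurePreserving_swap.measureReal_preimage
      (measurableSet_firstJumpSet v u).nullMeasurableSet,
    ← measureReal_union hdisj ((measurableSet_firstJumpSet v u).preimage measurable_swap)]
  refine measureReal_mono (Set.union_subset (firstJumpSet_subset u v) ?_)
  exact (Set.preimage_mono (firstJumpSet_subset v u)).trans (preimage_swap_meetSet u v).subset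

theorem isMeetingKernel_meetKernel : IsMeetingKernel (steps d R) (meetKernel (d := d) R) where
  nonneg _ _ := measureReal_nonneg
  diag := meetKernel_self
  superharmonic u v _ := by
    have hcard : (0 : ℝ) < (steps d R).card :=
      Nat.cast_pos.2 (Finset.nonempty_coe_sort.1 inferInstance).card_pos
    have hle := measureReal_firstJumpSet_add_le (R := R) u v
    rw [measureReal_firstJumpSet, measureReal_firstJumpSet, ← add_div,
      div_le_iff₀ (by positivity)] at hle
    simp only [Finset.sum_sub_distrib, Finset.sum_const, nsmul_eq_mul, meetKernel_comm u (v + _),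
      meetKernel_comm u v] at hle ⊢
    linarith

end Walk

/-! ### Block events and the correlation inequality -/

section Product

variable {V κ ι β Ω : Type*}

/-- The event that all the blocks `fun b => ζ (i, b)` with `i ∈ J` lie in `E₀`. -/
def blockEvent (E₀ : Set (β → Ω)) (J : Finset ι) : Set (ι × β → Ω) :=
  {ζ | ∀ i ∈ J, (fun b => ζ (i, b)) ∈ E₀}

theorem blockEvent_anti (E₀ : Set (β → Ω)) {J J' : Finset ι} (h : J' ⊆ J) :
    blockEvent E₀ J ⊆ blockEvent E₀ J' := fun _ hζ i hi => hζ i (h hi)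

variable [MeasurableSpace Ω] (ν : Measure Ω) [IsProbabilityMeasure ν]

theorem map_comp_infinitePi {X : κ → V} (hX : X.Injective) :
    (Measure.infinitePi fun _ : V => ν).map (· ∘ X) = Measure.infinitePi fun _ : κ => ν := by
  have hindep : iIndepFun (fun (y : V) (ξ : V → Ω) => ξ y) (Measure.infinitePi fun _ : V => ν) :=
    iIndepFun_infinitePi (X := fun _ b => b) fun _ => measurable_id
  refine ((hindep.precomp hX).map_fun_eq_infinitePi_map fun k => measurable_pi_apply _).trans ?_
  congr 1
  funext k
  exact (measurePreserving_eval_infinitePi (fun _ : V => ν) (X k)).map_eq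

theorem map_comp_infinitePi_absolutelyContinuous [Finite κ] [Countable Ω]
    [MeasurableSingletonClass Ω] (X : κ → V) :
    (Measure.infinitePi fun _ : V => ν).map (· ∘ X) ≪ Measure.infinitePi fun _ : κ => ν := by
  have := Fintype.ofFinite κ
  refine .mk fun E hE hνE => ?_
  rw [Measure.map_apply (by fun_prop) hE, ← Set.biUnion_preimage_singleton,
    measure_biUnion_null_iff E.to_countable]
  intro ζ hζ
  have hprod : ∏ k, ν {ζ k} = 0 := by
    rw [← Measure.infinitePi_singleton_of_fintype]
    exact measure_mono_null (Set.singleton_subset_iff.2 hζ) hνE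
  obtain ⟨k, -, hk⟩ := Finset.prod_eq_zero_iff.1 hprod
  refine measure_mono_null (fun ξ hξ => ?_) <| (measurePreserving_eval_infinitePi
    (fun _ : V => ν) (X k)).quasiMeasurePreserving.preimage_null hk
  exact congrFun hξ k

theorem infinitePi_blockEvent {E₀ : Set (β → Ω)} (hE₀ : MeasurableSet E₀) {J : Finset ι}
    {X : ι × β → V} (hX : Set.InjOn X {q | q.1 ∈ J}) :
    (Measure.infinitePi fun _ : V => ν) {ξ | ξ ∘ X ∈ blockEvent E₀ J}
      = (Measure.infinitePi fun _ : β => ν) E₀ ^ J.card := by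
  have hY : Function.Injective fun q : J × β => X (q.1, q.2) := fun q q' h => by
    have hq := hX q.1.2 q'.1.2 h
    grind
  have hlaw : (Measure.infinitePi fun _ : V => ν).map
      (MeasurableEquiv.curry J β Ω ∘ (· ∘ fun q : J × β => X (q.1, q.2)))
      = Measure.infinitePi fun _ : J => Measure.infinitePi fun _ : β => ν := by
    rw [← Measure.map_map (MeasurableEquiv.measurable _) (by fun_prop), map_comp_infinitePi ν hY]
    exact Measure.infinitePi_map_curry fun _ _ => ν
  have hblock : {ξ : V → Ω | ξ ∘ X ∈ blockEvent E₀ J}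
      = (MeasurableEquiv.curry J β Ω ∘ (· ∘ fun q : J × β => X (q.1, q.2))) ⁻¹'
        ((Finset.univ : Finset J) : Set J).pi fun _ => E₀ := by
    ext ξ
    simp only [Set.mem_preimage, Set.mem_pi, Finset.coe_univ, Set.mem_univ, true_imp_iff,
      Subtype.forall]
    rfl
  rw [hblock, ← Measure.map_apply (by fun_prop) (.pi (Set.to_countable _) fun _ _ => hE₀), hlaw,
    Measure.infinitePi_pi _ fun _ _ => hE₀, Finset.prod_const, Finset.card_univ,
    Fintype.card_coe]

theorem infinitePi_blockEvent_eq_zero [Finite β] [Countable Ω] [MeasurableSingletonClass Ω]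
    {E₀ : Set (β → Ω)} (hE₀ : Measure.infinitePi (fun _ : β => ν) E₀ = 0) {J : Finset ι}
    (hJ : J.Nonempty) (X : ι × β → V) :
    (Measure.infinitePi fun _ : V => ν) {ξ | ξ ∘ X ∈ blockEvent E₀ J} = 0 := by
  obtain ⟨i, hi⟩ := hJ
  have hnull := map_comp_infinitePi_absolutelyContinuous ν (fun b => X (i, b)) hE₀
  rw [Measure.map_apply (by fun_prop) (Set.to_countable _).measurableSet] at hnull
  exact measure_mono_null (fun ξ hξ => hξ i hi) hnull

end Product

section BlockIndicator

variable {ι β : Type*} [Finite β]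

theorem isClopen_blockEvent (E₀ : Set (β → Bool)) (J : Finset ι) :
    IsClopen (blockEvent E₀ J) := by
  have hInter : blockEvent E₀ J = ⋂ i ∈ J, (fun ζ b => ζ (i, b)) ⁻¹' E₀ := by
    ext; simp [blockEvent]
  rw [hInter]
  exact isClopen_biInter_finset fun i _ => (isClopen_discrete E₀).preimage (by fun_prop)

/-- The indicator function of `blockEvent E₀ J` as a continuous function, the event being
clopen. -/
def blockIndicator (E₀ : Set (β → Bool)) (J : Finset ι) : C(ι × β → Bool, ℝ) :=
  ⟨(blockEvent E₀ J).indicator 1, (isClopen_blockEvent E₀ J).continuous_indicator continuous_one⟩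

theorem blockIndicator_anti (E₀ : Set (β → Bool)) {J J' : Finset ι} (h : J' ⊆ J) :
    blockIndicator E₀ J ≤ blockIndicator E₀ J' :=
  Set.indicator_le_indicator_of_subset (blockEvent_anti E₀ h) fun _ => zero_le_one

theorem dependsOn_blockIndicator {β : Type*} [Fintype β] (E₀ : Set (β → Bool)) (J : Finset ι) :
    DependsOn (blockIndicator E₀ J) ((J ×ˢ Finset.univ : Finset (ι × β)) : Set (ι × β)) := by
  intro ζ ζ' h
  have hmem : ζ ∈ blockEvent E₀ J ↔ ζ' ∈ blockEvent E₀ J := forall₂_congr fun i hi => by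
    rw [funext fun b => h (i, b) (by simpa using hi)]
  by_cases hζ : ζ ∈ blockEvent E₀ J
  · simp [blockIndicator, hζ, hmem.1 hζ]
  · simp [blockIndicator, hζ, mt hmem.2 hζ]

variable {d R : ℕ} {E₀ : Set (β → Bool)} {J : Finset ι}

theorem integralFunctional_blockIndicator (π : Measure (Config d)) [IsFiniteMeasure π]
    (X : ι × β → Site d) :
    integralFunctional π ((blockIndicator E₀ J).comp (relabel X))
      = π.real {ξ | ξ ∘ X ∈ blockEvent E₀ J} := by
  have hmeas : MeasurableSet {ξ : Config d | ξ ∘ X ∈ blockEvent E₀ J} :=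
    ((isClopen_blockEvent E₀ J).preimage (relabel X).continuous).isOpen.measurableSet
  exact integral_indicator_one hmeas

variable {S : ℝ≥0 → C(Config d, ℝ) →ₗ[ℝ] C(Config d, ℝ)} {α : I}

instance : IsProbabilityMeasure (productBernoulli d α) := by
  unfold productBernoulli
  infer_instance

theorem integralFunctional_apply_blockIndicator_nonpos (hS : IsVoterSemigroup d R S)
    (hE₀ : (Measure.infinitePi fun _ : β => bernoulliMeasure true false α) E₀ = 0)
    (hJ : J.Nonempty) (X : ι × β → Site d) (t : ℝ≥0) :
    integralFunctional (productBernoulli d α)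
      (S t ((blockIndicator E₀ J).comp (relabel X))) ≤ 0 := by
  have := Fintype.ofFinite β
  have hinit : ∀ Y, integralFunctional (productBernoulli d α)
      ((blockIndicator E₀ J).comp (relabel Y)) = 0 := fun Y => by
    rw [integralFunctional_blockIndicator, measureReal_eq_zero_iff]
    exact infinitePi_blockEvent_eq_zero _ hE₀ hJ Y
  exact apply_comp_relabel_le hS (dependsOn_blockIndicator E₀ J) _ (W := 0) (fun _ => le_rfl)
    (fun Y => Or.inr ⟨by simp, (hinit Y).le⟩) X t

variable {μ : Measure (Config d)}

theorem IsVoterLimit.measureReal_le (hμ : IsVoterLimit d R α μ) (E₀ : Set (β → Bool))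
    (J : Finset ι) (X : ι × β → Site d) {c : ℝ}
    (h : ∀ S, IsVoterSemigroup d R S → ∀ t, integralFunctional (productBernoulli d α)
      (S t ((blockIndicator E₀ J).comp (relabel X))) ≤ c) :
    μ.real {ξ | ξ ∘ X ∈ blockEvent E₀ J} ≤ c := by
  obtain ⟨hprob, S, hS, hlim⟩ := hμ
  rw [← integralFunctional_blockIndicator]
  exact le_of_tendsto' (hlim _) (h S hS)

end BlockIndicator

section Correlation

variable {ι β : Type*} [Fintype β] {V : Type*} {η : V → V → ℝ} {p : ℝ}
  {prec : ι × β → ι × β → Prop}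

theorem inv_sq_sub_one_nonneg (hp : 0 < p) (hp₁ : p ≤ 1) : 0 ≤ (p ^ 2)⁻¹ - 1 :=
  sub_nonneg.2 ((one_le_inv₀ (by positivity)).2 (pow_le_one₀ hp.le hp₁))

/-- If two labels share a position, the blocks that contain them can be given up: their weight is
at most `p ^ 2`, which the new pair of labels of `matchingSum` makes up for. -/
theorem exists_ssubset_pow_mul_matchingSum_le [Std.Trichotomous prec] (hp : 0 < p) (hp₁ : p ≤ 1)
    (hη : ∀ u v, 0 ≤ η u v) (hdiag : ∀ u, η u u = 1) {J : Finset ι} {X : ι × β → V}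
    (hX : ¬ Set.InjOn X (J ×ˢ Finset.univ : Finset (ι × β))) :
    ∃ J' ⊂ J, p ^ J'.card * matchingSum prec ((p ^ 2)⁻¹ - 1) η (J' ×ˢ Finset.univ) X
      ≤ p ^ J.card * matchingSum prec ((p ^ 2)⁻¹ - 1) η (J ×ˢ Finset.univ) X := by
  classical
  have ha := inv_sq_sub_one_nonneg hp hp₁
  simp only [Set.InjOn, not_forall, Finset.mem_coe] at hX
  obtain ⟨u, hu, v, hv, hX, huv⟩ := hX
  set J' := (J.erase u.1).erase v.1 with hJ'
  have hsub : J' ⊆ J := (Finset.erase_subset _ _).trans (Finset.erase_subset _ _)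
  have hcard : J.card ≤ J'.card + 2 := by
    have h₁ := J.pred_card_le_card_erase (a := u.1)
    have h₂ := (J.erase u.1).pred_card_le_card_erase (a := v.1)
    rw [hJ']
    omega
  refine ⟨J', Finset.ssubset_iff_subset_ne.2 ⟨hsub, fun h => ?_⟩, ?_⟩
  · have huJ : u.1 ∈ J' := h ▸ (Finset.mem_product.1 hu).1
    simp [J'] at huJ
  calc p ^ J'.card * matchingSum prec ((p ^ 2)⁻¹ - 1) η (J' ×ˢ Finset.univ) X
      = p ^ (J'.card + 2) * ((1 + ((p ^ 2)⁻¹ - 1)) *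
          matchingSum prec ((p ^ 2)⁻¹ - 1) η (J' ×ˢ Finset.univ) X) := by
        rw [add_sub_cancel, pow_add, mul_assoc, mul_inv_cancel_left₀ (by positivity)]
    _ ≤ p ^ J.card * matchingSum prec ((p ^ 2)⁻¹ - 1) η (J ×ˢ Finset.univ) X := by
        refine mul_le_mul (pow_le_pow_of_le_one hp.le hp₁ hcard) ?_ ?_ (by positivity)
        · exact one_add_mul_matchingSum_le ha hη hdiag (Finset.product_subset_product_left hsub)
            (by simp_all [J']) (by simp_all [J']) huv hX
        · exact mul_nonneg (by linarith) (zero_le_one.trans (one_le_matchingSum ha hη _ X))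

variable {d R : ℕ} {E₀ : Set (β → Bool)} {J : Finset ι} {α : I}
  {S : ℝ≥0 → C(Config d, ℝ) →ₗ[ℝ] C(Config d, ℝ)}

theorem integralFunctional_apply_blockIndicator_le [Std.Trichotomous prec]
    (hS : IsVoterSemigroup d R S) {η : Site d → Site d → ℝ} (hη : IsMeetingKernel (steps d R) η)
    (hp : p = (Measure.infinitePi fun _ : β => bernoulliMeasure true false α).real E₀)
    (hp₀ : 0 < p) (X : ι × β → Site d) (t : ℝ≥0) :
    integralFunctional (productBernoulli d α) (S t ((blockIndicator E₀ J).comp (relabel X)))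
      ≤ p ^ J.card * matchingSum prec ((p ^ 2)⁻¹ - 1) η (J ×ˢ Finset.univ) X := by
  have hp₁ : p ≤ 1 := hp ▸ measureReal_le_one
  have ha := inv_sq_sub_one_nonneg hp₀ hp₁
  induction J using Finset.strongInduction generalizing X t with
  | H J ih =>
  have hone := one_le_matchingSum (prec := prec) ha hη.nonneg (J ×ˢ Finset.univ)
  refine apply_comp_relabel_le hS (dependsOn_blockIndicator E₀ J) _
    (W := fun X => p ^ J.card * matchingSum prec ((p ^ 2)⁻¹ - 1) η (J ×ˢ Finset.univ) X)
    (fun X => mul_nonneg (by positivity) (zero_le_one.trans (hone X))) (fun X => ?_) X t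
  by_cases hX : Set.InjOn X (J ×ˢ Finset.univ : Finset (ι × β))
  · refine Or.inr ⟨?_, ?_⟩
    · have hsmul := congrFun ((coalGen (steps d R) (J ×ˢ Finset.univ)).map_smul (p ^ J.card)
        (matchingSum prec ((p ^ 2)⁻¹ - 1) η (J ×ˢ Finset.univ))) X
      exact hsmul.trans_le <| mul_nonpos_of_nonneg_of_nonpos (by positivity)
        (coalGen_matchingSum_nonpos ha hη hX)
    · rw [integralFunctional_blockIndicator, measureReal_def, productBernoulli,
        infinitePi_blockEvent _ E₀.toFinite.measurableSet (hX.mono fun q hq => by simpa using hq),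
        ENNReal.toReal_pow, ← measureReal_def, ← hp]
      exact le_mul_of_one_le_right (by positivity) (hone X)
  · obtain ⟨J', hJ', hle⟩ := exists_ssubset_pow_mul_matchingSum_le (prec := prec) hp₀ hp₁ hη.nonneg
      hη.diag hX
    have hmono : (blockIndicator E₀ J).comp (relabel X) ≤ (blockIndicator E₀ J').comp (relabel X) :=
      fun ξ => blockIndicator_anti E₀ hJ'.subset _
    exact Or.inl fun t => (integralFunctional_mono _ (hS.markov.mono t hmono)).trans <|
      (ih J' hJ' X t).trans hle

end Correlation

section Translates

variable {κ V : Type*} {a : ℝ} {η : V → V → ℝ} {X : κ → V} {prec : V → V → Prop}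

open Classical in
theorem matchingSum_le_prod_image [DecidableEq V] (ha : 0 ≤ a) (hη : ∀ u v, 0 ≤ η u v)
    (A : Finset κ) (hX : X.Injective) :
    matchingSum (InvImage prec X) a η A X
      ≤ ∏ e ∈ (A.image X ×ˢ A.image X).filter (fun e : V × V => prec e.1 e.2),
          (1 + a * η e.1 e.2) := by
  have hone : ∀ e : V × V, 1 ≤ 1 + a * η e.1 e.2 := fun e =>
    le_add_of_nonneg_right (mul_nonneg ha (hη _ _))
  refine (matchingSum_le_prod ha hη A X).trans ?_
  refine (Finset.prod_image (f := fun e => 1 + a * η e.1 e.2)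
    (hX.prodMap hX).injOn).symm.trans_le ?_
  refine Finset.prod_le_prod_of_subset_of_one_le (Finset.image_subset_iff.2 fun e he => ?_)
    (fun e _ => zero_le_one.trans (hone e)) fun e _ _ => hone e
  obtain ⟨h₁, h₂, -, h⟩ := mem_orderedPairs.1 he
  exact Finset.mem_filter.2 ⟨Finset.mk_mem_product (Finset.mem_image_of_mem X h₁)
    (Finset.mem_image_of_mem X h₂), h⟩

variable {d R : ℕ} {α : I} {μ : Measure (Config d)} {prec : Site d → Site d → Prop}

open Classical in
theorem IsVoterLimit.measureReal_blockEvent_le {ι β : Type*} [Fintype ι] [Fintype β]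
    [Std.Trichotomous prec] (hμ : IsVoterLimit d R α μ) (hd : 0 < d) (hR : 1 ≤ R)
    {X : ι × β → Site d} (hX : X.Injective) {E₀ : Set (β → Bool)} {p : ℝ}
    (hp : p = (Measure.infinitePi fun _ : β => bernoulliMeasure true false α).real E₀) :
    μ.real {ξ | ξ ∘ X ∈ blockEvent E₀ Finset.univ} ≤ p ^ Fintype.card ι *
      ∏ e ∈ (Finset.univ.image X ×ˢ Finset.univ.image X).filter
          (fun e : Site d × Site d => prec e.1 e.2),
        (1 + meetProb R e.1 e.2 * ((p ^ 2)⁻¹ - 1)) := by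
  have : Nonempty (steps d R) := (steps_nonempty hd hR).to_subtype
  have : Std.Trichotomous (InvImage prec X) := InvImage.trichotomous hX
  have hp₁ : p ≤ 1 := hp ▸ measureReal_le_one
  have hη := isMeetingKernel_meetKernel (d := d) (R := R)
  obtain hp₀ | hp₀ := (hp ▸ measureReal_nonneg : 0 ≤ p).eq_or_lt
  · obtain _ | _ := isEmpty_or_nonempty ι
    · have := hμ.1
      simp
    · rw [← hp₀, zero_pow Fintype.card_ne_zero, zero_mul]
      refine hμ.measureReal_le E₀ _ X fun S hS t =>
        integralFunctional_apply_blockIndicator_nonpos hS ?_ Finset.univ_nonempty X t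
      exact (measureReal_eq_zero_iff (measure_ne_top _ _)).1 (hp.symm.trans hp₀.symm)
  · have ha := inv_sq_sub_one_nonneg hp₀ hp₁
    calc μ.real {ξ | ξ ∘ X ∈ blockEvent E₀ Finset.univ}
        ≤ p ^ Fintype.card ι *
            matchingSum (InvImage prec X) ((p ^ 2)⁻¹ - 1) (meetKernel R) Finset.univ X :=
          hμ.measureReal_le E₀ _ X fun S hS t => by
            simpa using integralFunctional_apply_blockIndicator_le (J := Finset.univ) hS hη hp hp₀
              X t
      _ ≤ p ^ Fintype.card ι * _ :=
          mul_le_mul_of_nonneg_left (matchingSum_le_prod_image ha hη.nonneg _ hX) (by positivity)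
      _ ≤ _ := by
          refine mul_le_mul_of_nonneg_left (Finset.prod_le_prod (fun e _ => ?_) fun e _ => ?_)
            (by positivity)
          · exact add_nonneg zero_le_one (mul_nonneg ha (hη.nonneg _ _))
          · rw [mul_comm]
            gcongr
            exact meetKernel_le_meetProb _ _

/-- The site `x i + b`, for `b ∈ B`. -/
def translate {ι : Type*} (x : ι → Site d) (B : Finset (Site d)) (q : ι × B) : Site d :=
  x q.1 + q.2

variable {ι : Type*} {x : ι → Site d} {B : Finset (Site d)}

theorem translate_injective
    (hx : Pairwise fun i j => Disjoint (B.image (x i + ·)) (B.image (x j + ·))) :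
    (translate x B).Injective := by
  rintro ⟨i, b⟩ ⟨j, c⟩ h
  obtain rfl : i = j := by
    by_contra hij
    exact Finset.disjoint_left.1 (hx hij) (Finset.mem_image_of_mem _ b.2)
      (Finset.mem_image.2 ⟨c, c.2, h.symm⟩)
  exact congrArg _ (Subtype.ext (add_left_cancel h))

theorem image_translate [Fintype ι] :
    Finset.univ.image (translate x B) = Finset.univ.biUnion fun i => B.image (x i + ·) := by
  ext z
  simp only [Finset.mem_image, Finset.mem_univ, true_and, Finset.mem_biUnion, translate,
    Prod.exists, Subtype.exists, exists_prop]

theorem mem_shiftEvent {z : Site d} {E : Set (Config d)} {ξ : Config d} :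
    ξ ∈ shiftEvent z E ↔ (fun b => ξ (z + b)) ∈ E := by
  constructor
  · rintro ⟨ζ, hζ, rfl⟩
    simpa [shift] using hζ
  · exact fun h => ⟨_, h, by ext; simp [shift]⟩

theorem iInter_shiftEvent [Fintype ι] (E₀ : Set (B → Bool)) :
    ⋂ i, shiftEvent (x i) {ξ | B.restrict ξ ∈ E₀}
      = {ξ | ξ ∘ translate x B ∈ blockEvent E₀ Finset.univ} := by
  ext ξ
  simp only [Set.mem_iInter, mem_shiftEvent, blockEvent, Finset.mem_univ, true_imp_iff]
  rfl

theorem productBernoulli_real_setOf_restrict_mem (E₀ : Set (B → Bool)) :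
    (productBernoulli d α).real {ξ | B.restrict ξ ∈ E₀}
      = (Measure.infinitePi fun _ : B => bernoulliMeasure true false α).real E₀ := by
  rw [← map_comp_infinitePi _ (Subtype.val_injective (p := (· ∈ B))),
    map_measureReal_apply (by fun_prop) E₀.toFinite.measurableSet]
  rfl

end Translates

end VoterModel

end

open VoterModel Classical in
theorem lemma2p2_general {d R : ℕ} (hd : 0 < d) (hR : 1 ≤ R) {α : unitInterval}
    {μ : MeasureTheory.Measure (Config d)} (hμ : IsVoterLimit d R α μ)
    (prec : Site d → Site d → Prop) [Std.Trichotomous prec] {B : Finset (Site d)}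
    {ι : Type*} [Fintype ι] {x : ι → Site d}
    (hx : Pairwise fun i j => Disjoint (B.image (x i + ·)) (B.image (x j + ·)))
    {E : Set (Config d)} (hE : E ∈ cylinderSets B) :
    μ.real (⋂ i, shiftEvent (x i) E) ≤
      (productBernoulli d α).real E ^ Fintype.card ι *
        ∏ p ∈ ((Finset.univ.biUnion fun i => B.image (x i + ·)) ×ˢ
            (Finset.univ.biUnion fun i => B.image (x i + ·))).filter
              (fun p : Site d × Site d => prec p.1 p.2),
          (1 + meetProb R p.1 p.2 * (((productBernoulli d α).real E ^ 2)⁻¹ - 1)) := by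
  obtain ⟨E₀, rfl⟩ := hE
  rw [iInter_shiftEvent, ← image_translate]
  exact hμ.measureReal_blockEvent_le hd hR (translate_injective hx)
    (productBernoulli_real_setOf_restrict_mem E₀)

open VoterModel Classical in
theorem lemma2p2 (d : ℕ) (hd : 3 ≤ d) (R : ℕ) (hR : 1 ≤ R) (α : unitInterval)
    (μ : MeasureTheory.Measure (Config d)) (hμ : IsVoterLimit d R α μ)
    (prec : Site d → Site d → Prop) [IsWellOrder (Site d) prec]
    (B : Finset (Site d)) (hB : 0 ∈ B) (n : ℕ) (x : Fin n → Site d)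
    (hx : Pairwise fun i j => Disjoint (B.image (x i + ·)) (B.image (x j + ·)))
    (E : Set (Config d)) (hE : E ∈ cylinderSets B) :
    μ.real (⋂ i, shiftEvent (x i) E) ≤
      (productBernoulli d α).real E ^ n *
        ∏ p ∈ ((Finset.univ.biUnion fun i => B.image (x i + ·)) ×ˢ
            (Finset.univ.biUnion fun i => B.image (x i + ·))).filter
              (fun p : Site d × Site d => prec p.1 p.2),
          (1 + meetProb R p.1 p.2 * (((productBernoulli d α).real E ^ 2)⁻¹ - 1)) := by
  simpa using lemma2p2_general (by omega) hR hμ prec hx hE
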